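/- Let $N$ be a norm on $\mathbb R^2$ that is of class $C^2$ on $\mathbb R^2\setminus\{0\}$, and suppose that its unit sphere $S=\{v\in\mathbb R^2: N(v)=1\}$ has strictly positive curvature at every point. Here the curvature of $S$ at $x$ is $\|\Phi''(t)\|_2$, where $\Phi$ is a $C^2$ parametrization of $S$ near $x$ by Euclidean arc length with $\Phi(t)=x$. Then $N$ is uniformly micro-semitransitive: for every $\varepsilon>0$ there is $\delta>0$ such that for all $x,y\in S$ with $N(x-y)<\delta$ there is a linear automorphism $T$ of $\mathbb R^2$ with $\|T\|\le 1$, $Tx=y$ and $\|T-I\|<\varepsilon$, where $\|L\|=\sup\{N(Lv): N(v)\le 1\}$ for every linear endomorphism $L$ of $\mathbb R^2$. -/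

import Mathlib

/-- The plane `ℝ²`, with its usual topology and Euclidean norm `‖·‖`. -/
abbrev Plane : Type := EuclideanSpace ℝ (Fin 2)

/-- `N` is a norm on the plane: a seminorm that vanishes only at the origin. -/
def IsNormOnPlane (N : Seminorm ℝ Plane) : Prop :=
  ∀ v : Plane, N v = 0 → v = 0

/-- The unit sphere `{v : N v = 1}`. -/
def unitSphere (N : Seminorm ℝ Plane) : Set Plane :=
  {v | N v = 1}

/-- A norm is of class `C²` when it is twice continuously differentiable off the origin
(no norm is differentiable at the origin). -/
def IsC2Norm (N : Seminorm ℝ Plane) : Prop :=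
  ContDiffOn ℝ 2 (fun v => N v) {0}ᶜ

/-- `Φ`, restricted to the open interval `(a, b)`, is a `C²` parametrization by Euclidean arc length
of a piece of the set `S`. -/
structure IsArcLengthArc (S : Set Plane) (Φ : ℝ → Plane) (a b : ℝ) : Prop where
  contDiffOn : ContDiffOn ℝ 2 Φ (Set.Ioo a b)
  unit_speed : ∀ s ∈ Set.Ioo a b, ‖deriv Φ s‖ = 1
  image_subset : Φ '' Set.Ioo a b ⊆ S

/-- The curvature at the parameter `t` of a curve parametrized by arc length: the Euclidean norm
of the second derivative. -/
noncomputable def arcCurvature (Φ : ℝ → Plane) (t : ℝ) : ℝ :=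
  ‖deriv (deriv Φ) t‖

/-- The plane curve `S` has curvature `κ` at its point `x`: near `x` the set `S` is parametrized by
an arc-length `C²` curve whose curvature at `x` is `κ`. -/
def HasCurvatureAt (S : Set Plane) (x : Plane) (κ : ℝ) : Prop :=
  ∃ (Φ : ℝ → Plane) (a b t : ℝ), IsArcLengthArc S Φ a b ∧ t ∈ Set.Ioo a b ∧ Φ t = x ∧
    Φ '' Set.Ioo a b ∈ nhdsWithin x S ∧ arcCurvature Φ t = κ

/-- The operator norm of a linear endomorphism of the plane normed by `N`:
`sup {N (T v) : N v ≤ 1}`. -/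
noncomputable def opNorm (N : Seminorm ℝ Plane) (T : Plane →ₗ[ℝ] Plane) : ℝ :=
  sSup ((fun v => N (T v)) '' {v | N v ≤ 1})

/-- When `N` is a norm, the supremum in `opNorm` is over a bounded set. -/
theorem bddAbove_opNorm {N : Seminorm ℝ Plane} (hN : IsNormOnPlane N)
    (T : Plane →ₗ[ℝ] Plane) : BddAbove ((fun v => N (T v)) '' {v | N v ≤ 1}) := by
  have hc : ∀ p : Seminorm ℝ Plane, Continuous p := fun p =>
    continuousOn_univ.1 (p.convexOn.continuousOn isOpen_univ)
  obtain ⟨w, hw, hmin⟩ := (isCompact_sphere (0 : Plane) 1).exists_isMinOn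
    ((NormedSpace.sphere_nonempty).2 zero_le_one) (hc N).continuousOn
  have hw1 : ‖w‖ = 1 := by simpa using hw
  have hm : 0 < N w := by
    refine lt_of_le_of_ne (apply_nonneg N w) fun h => ?_
    have := hN w h.symm
    simp [this] at hw1
  have hcpt : IsCompact {v : Plane | N v ≤ 1} := by
    refine Metric.isCompact_of_isClosed_isBounded
      (isClosed_le (hc N) continuous_const) ((Metric.isBounded_closedBall (x := (0 : Plane))
        (r := 1 / N w)).subset fun v hv => ?_)
    rw [mem_closedBall_zero_iff, le_div_iff₀ hm]
    rcases eq_or_ne v 0 with rfl | hv0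
    · simp
    · have hp : 0 < ‖v‖ := norm_pos_iff.2 hv0
      have h1 : N w ≤ N (‖v‖⁻¹ • v) := hmin (by simp [norm_smul, hp.ne'])
      rw [map_smul_eq_mul, norm_inv, norm_norm, inv_mul_eq_div, le_div_iff₀ hp] at h1
      have h2 : N v ≤ 1 := hv
      linarith
  exact (hcpt.image (hc (N.comp T))).bddAbove

/-- The plane with the norm `N` is uniformly micro-semitransitive: for each `ε > 0` there is `δ > 0`
such that any two points `x, y` of the unit sphere with `N (x - y) < δ` are related by `y = T x`
for a contractive automorphism `T` with `‖T - I‖ < ε` (operator norms taken with respect to `N`). -/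
def IsUMST (N : Seminorm ℝ Plane) : Prop :=
  ∀ ε : ℝ, 0 < ε → ∃ δ : ℝ, 0 < δ ∧
    ∀ x ∈ unitSphere N, ∀ y ∈ unitSphere N, N (x - y) < δ →
      ∃ T : Plane ≃ₗ[ℝ] Plane,
        opNorm N (T : Plane →ₗ[ℝ] Plane) ≤ 1 ∧ T x = y ∧
        opNorm N ((T : Plane →ₗ[ℝ] Plane) - LinearMap.id) < ε

/-!
For a unit vector `x` let `DN(x)` be the derivative of `N` at `x` and `v(x)` the tangent vector
`tangentVec N x`, the gradient turned by a right angle. Then `x, v(x)` is a basis that depends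
continuously on `x`, with dual basis `DN(x)`, `wedge x`. A contraction sending `x` to `y` must pull
`DN(y)` back to `DN(x)`, so it sends `v(x)` to `c • v(y)` for some real `c`, and the only freedom is
the factor `c`. The proof takes a fixed `c < 1`, close to `1`; this map is `frameMap N c x y`.

Positive curvature of the sphere says that the second derivative of `N` is positive in the tangent
direction (`IsC2Norm.fderiv_fderiv_tangentVec_pos`). Hence, for `x` and `y` near a unit vector `z`,
the function `s ↦ N (x + s v(x))` has a larger second derivative near `0` than
`s ↦ N (y + c s v(y))`, and it dominates the latter because both are `1 + o(s)`
(`IsC2Norm.eventually_tangent_line_le`). So `frameMap N c x y` does not increase the norm of vectors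
almost parallel to `z`. On the other vectors `frameMap N c z z` decreases the norm strictly, because
the sphere contains no segment (`IsC2Norm.abs_fderiv_lt`), and this persists for `x`, `y` near `z`
by continuity. Compactness of the sphere makes the neighbourhood of `z` independent of the vector
(`IsC2Norm.eventually_exists_contraction`), and compactness once more makes `δ` independent of `z`.
-/

open Filter Topology Set

/-! ### A norm and its derivative -/

/-- The area form `det (x, w)` of the plane. -/
def wedge (x w : Plane) : ℝ := x 0 * w 1 - x 1 * w 0

/-- The gradient of `N` at `x` turned by a right angle: a tangent vector of the level set of `N`
through `x`. It is scaled so that its wedge with `x` is `N x`. -/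
noncomputable def tangentVec (N : Seminorm ℝ Plane) (x : Plane) : Plane :=
  !₂[-(fderiv ℝ N x (EuclideanSpace.single 1 1)), fderiv ℝ N x (EuclideanSpace.single 0 1)]

theorem clm_apply_eq (f : Plane →L[ℝ] ℝ) (w : Plane) :
    f w = w 0 * f (EuclideanSpace.single 0 1) + w 1 * f (EuclideanSpace.single 1 1) := by
  have hw : w = w 0 • EuclideanSpace.single 0 (1 : ℝ) + w 1 • EuclideanSpace.single 1 (1 : ℝ) := by
    ext i
    fin_cases i <;> simp
  conv_lhs => rw [hw]
  simp

theorem continuous_seminorm_plane (N : Seminorm ℝ Plane) : Continuous N :=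
  continuousOn_univ.1 (N.convexOn.continuousOn isOpen_univ)

theorem IsNormOnPlane.pos {N : Seminorm ℝ Plane} (hN : IsNormOnPlane N) {v : Plane} (hv : v ≠ 0) :
    0 < N v :=
  lt_of_le_of_ne (apply_nonneg N v) fun h => hv (hN v h.symm)

theorem ne_zero_of_mem_unitSphere {N : Seminorm ℝ Plane} {x : Plane} (hx : x ∈ unitSphere N) :
    x ≠ 0 := by
  rintro rfl
  simp [unitSphere] at hx

theorem isCompact_unitBall {N : Seminorm ℝ Plane} (hN : IsNormOnPlane N) :
    IsCompact {v : Plane | N v ≤ 1} := by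
  have hc := continuous_seminorm_plane N
  obtain ⟨w, hw, hmin⟩ := (isCompact_sphere (0 : Plane) 1).exists_isMinOn
    ((NormedSpace.sphere_nonempty).2 zero_le_one) hc.continuousOn
  have hm : 0 < N w := hN.pos (by rintro rfl; simp at hw)
  refine Metric.isCompact_of_isClosed_isBounded
    (isClosed_le hc continuous_const) ((Metric.isBounded_closedBall (x := (0 : Plane))
      (r := 1 / N w)).subset fun v hv => ?_)
  rw [mem_closedBall_zero_iff, le_div_iff₀ hm]
  rcases eq_or_ne v 0 with rfl | hv0
  · simp
  · have hp : 0 < ‖v‖ := norm_pos_iff.2 hv0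
    have h1 : N w ≤ N (‖v‖⁻¹ • v) := hmin (by simp [norm_smul, hp.ne'])
    rw [map_smul_eq_mul, norm_inv, norm_norm, inv_mul_eq_div, le_div_iff₀ hp] at h1
    have h2 : N v ≤ 1 := hv
    linarith

theorem isCompact_unitSphere {N : Seminorm ℝ Plane} (hN : IsNormOnPlane N) :
    IsCompact (unitSphere N) :=
  (isCompact_unitBall hN).of_isClosed_subset
    (isClosed_eq (continuous_seminorm_plane N) continuous_const) fun _ hv => le_of_eq hv

section

variable {N : Seminorm ℝ Plane} {x : Plane}

theorem IsC2Norm.contDiffAt (hC2 : IsC2Norm N) (hx : x ≠ 0) : ContDiffAt ℝ 2 N x :=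
  ContDiffOn.contDiffAt hC2 (isOpen_compl_singleton.mem_nhds hx)

theorem IsC2Norm.hasFDerivAt (hC2 : IsC2Norm N) (hx : x ≠ 0) : HasFDerivAt N (fderiv ℝ N x) x :=
  ((hC2.contDiffAt hx).differentiableAt (by norm_num)).hasFDerivAt

theorem IsC2Norm.contDiffAt_fderiv (hC2 : IsC2Norm N) (hx : x ≠ 0) :
    ContDiffAt ℝ 1 (fderiv ℝ N) x :=
  (hC2.contDiffAt hx).fderiv_right (by norm_num)

theorem IsC2Norm.hasFDerivAt_fderiv (hC2 : IsC2Norm N) (hx : x ≠ 0) :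
    HasFDerivAt (fderiv ℝ N) (fderiv ℝ (fderiv ℝ N) x) x :=
  ((hC2.contDiffAt_fderiv hx).differentiableAt (by norm_num)).hasFDerivAt

theorem IsC2Norm.continuousAt_fderiv (hC2 : IsC2Norm N) (hx : x ≠ 0) :
    ContinuousAt (fderiv ℝ N) x :=
  (hC2.contDiffAt_fderiv hx).continuousAt

theorem IsC2Norm.continuousAt_fderiv_fderiv (hC2 : IsC2Norm N) (hx : x ≠ 0) :
    ContinuousAt (fderiv ℝ (fderiv ℝ N)) x :=
  ((hC2.contDiffAt_fderiv hx).fderiv_right (m := 0) (by norm_num)).continuousAt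

theorem IsC2Norm.continuousAt_tangentVec (hC2 : IsC2Norm N) (hx : x ≠ 0) :
    ContinuousAt (tangentVec N) x := by
  have h := hC2.continuousAt_fderiv hx
  unfold tangentVec
  refine (PiLp.continuous_toLp 2 _).continuousAt.comp (continuousAt_pi.2 fun i => ?_)
  fin_cases i
  · exact (h.clm_apply continuousAt_const).neg
  · exact h.clm_apply continuousAt_const

/-- Euler's identity for the homogeneous function `N`. -/
theorem IsC2Norm.fderiv_self (hC2 : IsC2Norm N) (hx : x ≠ 0) : fderiv ℝ N x x = N x := by
  have h1 : HasDerivAt (fun s : ℝ => N (x + s • x)) (fderiv ℝ N x x) 0 := by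
    have := (hC2.hasFDerivAt hx).hasLineDerivAt x
    exact this
  have h2 : HasDerivAt (fun s : ℝ => (1 + s) * N x) (1 * N x) 0 :=
    ((hasDerivAt_id 0).const_add 1).mul_const _
  have h3 : (fun s : ℝ => N (x + s • x)) =ᶠ[𝓝 0] fun s : ℝ => (1 + s) * N x := by
    filter_upwards [lt_mem_nhds (show (-1 : ℝ) < 0 by norm_num)] with s hs
    have : x + s • x = (1 + s) • x := by rw [add_smul, one_smul]
    rw [this, map_smul_eq_mul, Real.norm_of_nonneg (by linarith)]
  have := h1.unique (h2.congr_of_eventuallyEq h3)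
  simpa using this

/-- The derivative of a norm is a functional of norm at most one. -/
theorem IsC2Norm.fderiv_le (hC2 : IsC2Norm N) (hx : x ≠ 0) (w : Plane) : fderiv ℝ N x w ≤ N w := by
  have h1 : HasDerivAt (fun s : ℝ => N (x + s • w)) (fderiv ℝ N x w) 0 :=
    (hC2.hasFDerivAt hx).hasLineDerivAt w
  refine le_of_tendsto h1.tendsto_slope_zero_right ?_
  filter_upwards [self_mem_nhdsWithin] with s hs
  have hs : 0 < s := hs
  have h2 : N (x + s • w) ≤ N x + s * N w := by
    simpa [map_smul_eq_mul, abs_of_pos hs] using map_add_le_add N x (s • w)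
  simp only [zero_add, zero_smul, add_zero, smul_eq_mul]
  rw [inv_mul_le_iff₀ hs]
  linarith

theorem IsC2Norm.abs_fderiv_le (hC2 : IsC2Norm N) (hx : x ≠ 0) (w : Plane) :
    |fderiv ℝ N x w| ≤ N w := by
  refine abs_le.2 ⟨?_, hC2.fderiv_le hx w⟩
  have := hC2.fderiv_le hx (-w)
  rw [map_neg, map_neg_eq_map] at this
  linarith

theorem fderiv_tangentVec (N : Seminorm ℝ Plane) (x : Plane) :
    fderiv ℝ N x (tangentVec N x) = 0 := by
  rw [clm_apply_eq]
  simp [tangentVec]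
  ring

theorem IsC2Norm.wedge_tangentVec (hC2 : IsC2Norm N) (hx : x ∈ unitSphere N) :
    wedge x (tangentVec N x) = 1 := by
  have h := hC2.fderiv_self (ne_zero_of_mem_unitSphere hx)
  rw [clm_apply_eq, show N x = 1 from hx] at h
  simpa [wedge, tangentVec] using h

/-- At a unit vector `x` the vectors `x` and `tangentVec N x` form a basis of the plane, with dual
basis the derivative of `N` at `x` and `wedge x`. -/
theorem IsC2Norm.decomp (hC2 : IsC2Norm N) (hx : x ∈ unitSphere N) (w : Plane) :
    w = fderiv ℝ N x w • x + wedge x w • tangentVec N x := by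
  have h := hC2.fderiv_self (ne_zero_of_mem_unitSphere hx)
  rw [clm_apply_eq, show N x = 1 from hx] at h
  rw [clm_apply_eq (fderiv ℝ N x) w]
  ext i
  fin_cases i
  · simp [wedge, tangentVec]
    linear_combination (-w 0) * h
  · simp [wedge, tangentVec]
    linear_combination (-w 1) * h

theorem IsC2Norm.tangentVec_ne_zero (hC2 : IsC2Norm N) (hx : x ∈ unitSphere N) :
    tangentVec N x ≠ 0 := by
  intro h
  have := hC2.wedge_tangentVec hx
  rw [h] at this
  simp [wedge] at this

/-! ### Positivity of the second derivative -/

/-- The second derivative of `N` is nonnegative, by convexity. -/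
theorem IsC2Norm.fderiv_fderiv_nonneg (hC2 : IsC2Norm N) (hx : x ≠ 0) (v : Plane) :
    0 ≤ fderiv ℝ (fderiv ℝ N) x v v := by
  have h1 : HasDerivAt (fun s : ℝ => fderiv ℝ N (x + s • v)) (fderiv ℝ (fderiv ℝ N) x v) 0 :=
    (hC2.hasFDerivAt_fderiv hx).hasLineDerivAt v
  have h2 : HasDerivAt (fun s : ℝ => fderiv ℝ N (x + s • v) v) (fderiv ℝ (fderiv ℝ N) x v v) 0 := by
    simpa using h1.clm_apply (hasDerivAt_const 0 v)
  refine ge_of_tendsto h2.tendsto_slope_zero_right ?_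
  have hne : ∀ᶠ s : ℝ in 𝓝[>] 0, x + s • v ≠ 0 := by
    have hc : ContinuousAt (fun s : ℝ => x + s • v) 0 := by fun_prop
    exact (hc.eventually_ne (by simpa using hx)).filter_mono nhdsWithin_le_nhds
  filter_upwards [self_mem_nhdsWithin, hne] with s hs hu
  have hs : 0 < s := hs
  simp only [zero_add, zero_smul, add_zero, smul_eq_mul]
  refine mul_nonneg (inv_nonneg.2 hs.le) ?_
  have e1 := hC2.fderiv_self hu
  have e2 := hC2.fderiv_self hx
  have e3 := hC2.fderiv_le hu x
  have e4 := hC2.fderiv_le hx (x + s • v)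
  simp only [map_add, map_smul, smul_eq_mul] at e1 e4
  have : 0 ≤ s * (fderiv ℝ N (x + s • v) v - fderiv ℝ N x v) := by linarith
  exact nonneg_of_mul_nonneg_right this hs

/-- If the unit sphere has positive curvature at `x`, then the second derivative of `N` is positive
in the tangent direction. For an arc `Φ` in the sphere, `N ∘ Φ = 1` gives
`D²N (Φ', Φ') = -DN (Φ'')`; if that vanished, `Φ''` would be tangent, while it is normal to the
unit vector `Φ'`. -/
theorem IsC2Norm.fderiv_fderiv_tangentVec_pos (hC2 : IsC2Norm N) (hx : x ∈ unitSphere N)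
    {κ : ℝ} (hκ : 0 < κ)
    (h : HasCurvatureAt (unitSphere N) x κ) :
    0 < fderiv ℝ (fderiv ℝ N) x (tangentVec N x) (tangentVec N x) := by
  have hx0 := ne_zero_of_mem_unitSphere hx
  obtain ⟨Φ, a, b, t, hΦ, ht, rfl, -, rfl⟩ := h
  have hI : Ioo a b ∈ 𝓝 t := isOpen_Ioo.mem_nhds ht
  have hdiff : ∀ s ∈ Ioo a b, HasDerivAt Φ (deriv Φ s) s := fun s hs =>
    ((hΦ.contDiffOn.contDiffAt (isOpen_Ioo.mem_nhds hs)).differentiableAt (by norm_num)).hasDerivAt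
  have hdiff2 : HasDerivAt (deriv Φ) (deriv (deriv Φ) t) t := by
    have h2 : ContDiffOn ℝ 1 (deriv Φ) (Ioo a b) :=
      hΦ.contDiffOn.deriv_of_isOpen isOpen_Ioo (by norm_num)
    exact ((h2.contDiffAt hI).differentiableAt (by norm_num)).hasDerivAt
  have hmem : ∀ s ∈ Ioo a b, Φ s ∈ unitSphere N := fun s hs => hΦ.image_subset ⟨s, hs, rfl⟩
  have htan : ∀ s ∈ Ioo a b, fderiv ℝ N (Φ s) (deriv Φ s) = 0 := by
    intro s hs
    have h1 := (hC2.hasFDerivAt (ne_zero_of_mem_unitSphere (hmem s hs))).comp_hasDerivAt s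
      (hdiff s hs)
    have h2 : (N ∘ Φ) =ᶠ[𝓝 s] fun _ => 1 := by
      filter_upwards [isOpen_Ioo.mem_nhds hs] with u hu using hmem u hu
    exact h1.unique ((hasDerivAt_const s 1).congr_of_eventuallyEq h2)
  have hsecond : fderiv ℝ (fderiv ℝ N) (Φ t) (deriv Φ t) (deriv Φ t)
      + fderiv ℝ N (Φ t) (deriv (deriv Φ) t) = 0 := by
    have h1 := ((hC2.hasFDerivAt_fderiv hx0).comp_hasDerivAt t (hdiff t ht)).clm_apply hdiff2
    have h2 : (fun s => (fderiv ℝ N ∘ Φ) s (deriv Φ s)) =ᶠ[𝓝 t] fun _ => 0 := by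
      filter_upwards [hI] with u hu using htan u hu
    exact h1.unique ((hasDerivAt_const t 0).congr_of_eventuallyEq h2)
  have hperp : inner ℝ (deriv Φ t) (deriv (deriv Φ) t) = 0 := by
    have h1 := hdiff2.norm_sq
    have h2 : (fun s => ‖deriv Φ s‖ ^ 2) =ᶠ[𝓝 t] fun _ => 1 := by
      filter_upwards [hI] with u hu
      rw [hΦ.unit_speed u hu, one_pow]
    have := h1.unique ((hasDerivAt_const t 1).congr_of_eventuallyEq h2)
    linarith
  have hker : ∀ w, fderiv ℝ N (Φ t) w = 0 → w = wedge (Φ t) w • tangentVec N (Φ t) := by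
    intro w hw
    simpa [hw] using hC2.decomp hx w
  have hΦ' := hker _ (htan t ht)
  set c := wedge (Φ t) (deriv Φ t)
  refine lt_of_le_of_ne (hC2.fderiv_fderiv_nonneg hx0 _) fun h0 => ?_
  have h1 : fderiv ℝ (fderiv ℝ N) (Φ t) (deriv Φ t) (deriv Φ t) = 0 := by
    rw [hΦ']
    simp [← h0]
  rw [h1, zero_add] at hsecond
  have hΦ'' := hker _ hsecond
  set d := wedge (Φ t) (deriv (deriv Φ) t)
  have hc : c ≠ 0 := by
    intro hc
    have := hΦ.unit_speed t ht
    rw [hΦ', hc] at this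
    simp at this
  have hv := hC2.tangentVec_ne_zero hx
  rw [hΦ', hΦ'', inner_smul_left, inner_smul_right] at hperp
  have hd : d = 0 := by simpa [hc, hv] using hperp
  rw [arcCurvature, hΦ'', hd] at hκ
  simp at hκ

/-- Positive curvature at the unit vector `x` makes `x` the only unit vector, up to sign, at which
the derivative of `N` at `x` attains its norm: otherwise the sphere would contain a segment. -/
theorem IsC2Norm.abs_fderiv_lt (hC2 : IsC2Norm N) (hN : IsNormOnPlane N) (hx : x ∈ unitSphere N)
    (hpos : 0 < fderiv ℝ (fderiv ℝ N) x (tangentVec N x) (tangentVec N x))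
    {w : Plane} (hw : wedge x w ≠ 0) : |fderiv ℝ N x w| < N w := by
  by_contra! hle
  have hx0 := ne_zero_of_mem_unitSphere hx
  have hw0 : w ≠ 0 := by
    rintro rfl
    simp [wedge] at hw
  set c := fderiv ℝ N x w with hc
  have hc0 : c ≠ 0 := by
    intro h
    rw [h, abs_zero] at hle
    exact absurd (hN.pos hw0) (not_lt.2 hle)
  -- The unit vector `u = w / c` lies on the tangent line `DN(x) = 1`.
  set v := tangentVec N x with hv
  set s := c⁻¹ * wedge x w with hs
  have hs0 : s ≠ 0 := mul_ne_zero (inv_ne_zero hc0) hw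
  have hu : x + s • v = c⁻¹ • w := by
    rw [hC2.decomp hx w, ← hc, ← hv, smul_add, smul_smul, smul_smul, inv_mul_cancel₀ hc0, one_smul]
  have hNu : N (x + s • v) ≤ 1 := by
    rw [hu, map_smul_eq_mul, norm_inv, Real.norm_eq_abs, inv_mul_le_iff₀ (abs_pos.2 hc0), mul_one]
    exact hle
  have hzero : ∀ t ∈ Ioo (0 : ℝ) 1, fderiv ℝ N (x + t • s • v) v = 0 := by
    intro t ht
    set p := x + t • s • v with hp
    have hfp : fderiv ℝ N x p = 1 := by
      rw [hp, map_add, map_smul, map_smul, fderiv_tangentVec, hC2.fderiv_self hx0,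
        show N x = 1 from hx]
      simp
    have hNp : N p = 1 := by
      refine le_antisymm ?_ (hfp ▸ hC2.fderiv_le hx0 p)
      have e : p = (1 - t) • x + t • (x + s • v) := by rw [hp]; module
      calc N p ≤ N ((1 - t) • x) + N (t • (x + s • v)) := by
            rw [e]
            exact map_add_le_add N _ _
        _ = (1 - t) * N x + t * N (x + s • v) := by
            rw [map_smul_eq_mul, map_smul_eq_mul, Real.norm_of_nonneg (by linarith [ht.2]),
              Real.norm_of_nonneg ht.1.le]
        _ ≤ (1 - t) * 1 + t * 1 := by
            have := show N x = 1 from hx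
            have := mul_le_mul_of_nonneg_left hNu ht.1.le
            rw [‹N x = 1›]
            linarith
        _ = 1 := by ring
    -- `N - DN(x)` is nonnegative and vanishes at `p`.
    have hmin : IsLocalMin (fun q => N q - fderiv ℝ N x q) p := by
      refine Filter.Eventually.of_forall fun q => ?_
      simp only [hNp, hfp, sub_self]
      exact sub_nonneg.2 (hC2.fderiv_le hx0 q)
    have h1 := hmin.hasFDerivAt_eq_zero
      ((hC2.hasFDerivAt (ne_zero_of_mem_unitSphere hNp)).sub (fderiv ℝ N x).hasFDerivAt)
    have h2 := congrArg (fun L : Plane →L[ℝ] ℝ => L v) h1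
    simpa [hv, fderiv_tangentVec] using h2
  have h1 : HasDerivAt (fun t : ℝ => fderiv ℝ N (x + t • s • v))
      (fderiv ℝ (fderiv ℝ N) x (s • v)) 0 :=
    (hC2.hasFDerivAt_fderiv hx0).hasLineDerivAt (s • v)
  have h2 : HasDerivAt (fun t : ℝ => fderiv ℝ N (x + t • s • v) v)
      (fderiv ℝ (fderiv ℝ N) x (s • v) v) 0 := by
    simpa using h1.clm_apply (hasDerivAt_const 0 v)
  have h3 : fderiv ℝ (fderiv ℝ N) x (s • v) v = 0 := by
    refine tendsto_nhds_unique h2.tendsto_slope_zero_right (tendsto_const_nhds.congr' ?_)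
    filter_upwards [Ioo_mem_nhdsGT (zero_lt_one' ℝ)] with t ht
    simp only [zero_add, zero_smul, add_zero]
    rw [hzero t ht, hv, fderiv_tangentVec]
    simp
  rw [map_smul] at h3
  have h4 : s * fderiv ℝ (fderiv ℝ N) x v v = 0 := h3
  exact (mul_ne_zero hs0 hpos.ne') h4
end

/-! ### Local comparison along tangent lines -/

/-- A function with nonnegative second derivative that vanishes to first order at `0` is
nonnegative. -/
theorem nonneg_of_hasDerivAt2_nonneg {r : ℝ} {h h' h'' : ℝ → ℝ}
    (h1 : ∀ s ∈ Ioo (-r) r, HasDerivAt h (h' s) s)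
    (h2 : ∀ s ∈ Ioo (-r) r, HasDerivAt h' (h'' s) s)
    (h3 : ∀ s ∈ Ioo (-r) r, 0 ≤ h'' s) (h0 : h 0 = 0) (h0' : h' 0 = 0) {s : ℝ}
    (hs : s ∈ Ioo (-r) r) : 0 ≤ h s := by
  have hr : (0 : ℝ) ∈ Ioo (-r) r := ⟨by linarith [hs.1, hs.2], by linarith [hs.1, hs.2]⟩
  have hconv : ConvexOn ℝ (Ioo (-r) r) h := by
    refine convexOn_of_hasDerivWithinAt2_nonneg (f' := h') (f'' := h'') (convex_Ioo _ _)
      (fun s hs => (h1 s hs).continuousAt.continuousWithinAt) ?_ ?_ ?_ <;> rw [interior_Ioo]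
    · exact fun s hs => (h1 s hs).hasDerivWithinAt
    · exact fun s hs => (h2 s hs).hasDerivWithinAt
    · exact h3
  have hmin := hconv.isMinOn_of_rightDeriv_eq_zero (x := 0) (by rwa [interior_Ioo]) (by
    rw [((h1 0 hr).hasDerivWithinAt).derivWithin (uniqueDiffWithinAt_Ioi 0), h0'])
  simpa [h0] using hmin hs

section

variable {N : Seminorm ℝ Plane} {z : Plane}

theorem IsC2Norm.hasDerivAt_line (hC2 : IsC2Norm N) {y v : Plane} {c s : ℝ}
    (h : y + (c * s) • v ≠ 0) :
    HasDerivAt (fun s : ℝ => N (y + (c * s) • v)) (c * fderiv ℝ N (y + (c * s) • v) v) s := by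
  have hl : HasDerivAt (fun s : ℝ => y + (c * s) • v) ((c * 1) • v) s :=
    (((hasDerivAt_id s).const_mul c).smul_const v).const_add y
  simpa [Function.comp_def] using (hC2.hasFDerivAt h).comp_hasDerivAt s hl

theorem IsC2Norm.hasDerivAt_fderiv_line (hC2 : IsC2Norm N) {y v : Plane} {c s : ℝ}
    (h : y + (c * s) • v ≠ 0) :
    HasDerivAt (fun s : ℝ => c * fderiv ℝ N (y + (c * s) • v) v)
      (c ^ 2 * fderiv ℝ (fderiv ℝ N) (y + (c * s) • v) v v) s := by
  have hl : HasDerivAt (fun s : ℝ => y + (c * s) • v) ((c * 1) • v) s :=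
    (((hasDerivAt_id s).const_mul c).smul_const v).const_add y
  have h1 : HasDerivAt (fun s : ℝ => fderiv ℝ N (y + (c * s) • v))
      (fderiv ℝ (fderiv ℝ N) (y + (c * s) • v) ((c * 1) • v)) s :=
    (hC2.hasFDerivAt_fderiv h).comp_hasDerivAt s hl
  have h2 : HasDerivAt (fun s : ℝ => fderiv ℝ N (y + (c * s) • v) v)
      (fderiv ℝ (fderiv ℝ N) (y + (c * s) • v) ((c * 1) • v) v) s := by
    simpa using h1.clm_apply (hasDerivAt_const s v)
  refine (h2.const_mul c).congr_deriv ?_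
  rw [map_smul, mul_one, smul_apply, smul_eq_mul]
  ring

/-- For nearby unit vectors `x`, `y` the norm grows faster along the tangent line at `x` than along
the tangent line at `y` traversed at speed `c < 1`: both functions are `1 + o(s)`, and near
`s = 0` the second derivative of the first one is at least that of the second one, which carries a
factor `c²`. -/
theorem IsC2Norm.eventually_tangent_line_le (hC2 : IsC2Norm N) (hz : z ∈ unitSphere N)
    (hpos : 0 < fderiv ℝ (fderiv ℝ N) z (tangentVec N z) (tangentVec N z))
    {c : ℝ} (hc0 : 0 ≤ c) (hc1 : c < 1) :
    ∀ᶠ p : Plane × Plane × ℝ in 𝓝 (z, z, 0), p.1 ∈ unitSphere N → p.2.1 ∈ unitSphere N →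
      N (p.2.1 + (c * p.2.2) • tangentVec N p.2.1) ≤ N (p.1 + p.2.2 • tangentVec N p.1) := by
  have hz0 := ne_zero_of_mem_unitSphere hz
  have hv := hC2.continuousAt_tangentVec hz0
  have hv1 : ContinuousAt (fun p : Plane × Plane × ℝ => tangentVec N p.1) (z, z, 0) :=
    ContinuousAt.comp (f := fun p : Plane × Plane × ℝ => p.1) (x := (z, z, 0)) hv continuousAt_fst
  have hv2 : ContinuousAt (fun p : Plane × Plane × ℝ => tangentVec N p.2.1) (z, z, 0) :=
    ContinuousAt.comp (f := fun p : Plane × Plane × ℝ => p.2.1) (x := (z, z, 0)) hv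
      (by fun_prop)
  have hx : ContinuousAt (fun p : Plane × Plane × ℝ => p.1 + (1 * p.2.2) • tangentVec N p.1)
      (z, z, 0) := by fun_prop
  have hy : ContinuousAt (fun p : Plane × Plane × ℝ => p.2.1 + (c * p.2.2) • tangentVec N p.2.1)
      (z, z, 0) := by fun_prop
  have hD := hC2.continuousAt_fderiv_fderiv hz0
  have hD1 : ContinuousAt (fun p : Plane × Plane × ℝ =>
      fderiv ℝ (fderiv ℝ N) (p.1 + (1 * p.2.2) • tangentVec N p.1)) (z, z, 0) :=
    ContinuousAt.comp (f := fun p : Plane × Plane × ℝ => p.1 + (1 * p.2.2) • tangentVec N p.1)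
      (x := (z, z, 0)) (by simpa using hD) hx
  have hD2 : ContinuousAt (fun p : Plane × Plane × ℝ =>
      fderiv ℝ (fderiv ℝ N) (p.2.1 + (c * p.2.2) • tangentVec N p.2.1)) (z, z, 0) :=
    ContinuousAt.comp (f := fun p : Plane × Plane × ℝ => p.2.1 + (c * p.2.2) • tangentVec N p.2.1)
      (x := (z, z, 0)) (by simpa using hD) hy
  have hF1 := (hD1.clm_apply hv1).clm_apply hv1
  have hF2 := (hD2.clm_apply hv2).clm_apply hv2
  have hlt : ∀ᶠ p : Plane × Plane × ℝ in 𝓝 (z, z, 0),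
      c ^ 2 * fderiv ℝ (fderiv ℝ N) (p.2.1 + (c * p.2.2) • tangentVec N p.2.1)
        (tangentVec N p.2.1) (tangentVec N p.2.1) <
      fderiv ℝ (fderiv ℝ N) (p.1 + (1 * p.2.2) • tangentVec N p.1)
        (tangentVec N p.1) (tangentVec N p.1) := by
    refine (hF2.const_mul (c ^ 2)).eventually_lt hF1 ?_
    have : c ^ 2 < 1 := by nlinarith
    simpa using mul_lt_of_lt_one_left hpos this
  have hall := hlt.and ((hx.eventually_ne (y := 0) (by simpa using hz0)).and
    (hy.eventually_ne (y := 0) (by simpa using hz0)))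
  obtain ⟨r, hr, hball⟩ := Metric.eventually_nhds_iff.1 hall
  filter_upwards [Metric.ball_mem_nhds _ hr] with ⟨x, y, s⟩ hp hxS hyS
  have hp : dist (x, y, s) (z, z, (0 : ℝ)) < r := hp
  simp only [Prod.dist_eq, max_lt_iff] at hp
  have hgood : ∀ t ∈ Ioo (-r) r, _ := fun t (ht : t ∈ Ioo (-r) r) =>
    hball (y := (x, y, t)) (by
      simp only [Prod.dist_eq, max_lt_iff]
      exact ⟨hp.1, hp.2.1, by simpa [Real.dist_eq, abs_lt] using ht⟩)
  have hs : s ∈ Ioo (-r) r := by simpa [Real.dist_eq, abs_lt] using hp.2.2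
  have key := nonneg_of_hasDerivAt2_nonneg (r := r) (s := s)
    (h := fun t => N (x + (1 * t) • tangentVec N x) - N (y + (c * t) • tangentVec N y))
    (h' := fun t => 1 * fderiv ℝ N (x + (1 * t) • tangentVec N x) (tangentVec N x)
      - c * fderiv ℝ N (y + (c * t) • tangentVec N y) (tangentVec N y))
    (h'' := fun t =>
      1 ^ 2 * fderiv ℝ (fderiv ℝ N) (x + (1 * t) • tangentVec N x) (tangentVec N x) (tangentVec N x)
      - c ^ 2 * fderiv ℝ (fderiv ℝ N) (y + (c * t) • tangentVec N y)
        (tangentVec N y) (tangentVec N y))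
    (fun t ht => (hC2.hasDerivAt_line (hgood t ht).2.1).sub (hC2.hasDerivAt_line (hgood t ht).2.2))
    (fun t ht => (hC2.hasDerivAt_fderiv_line (hgood t ht).2.1).sub
      (hC2.hasDerivAt_fderiv_line (hgood t ht).2.2))
    (fun t ht => by
      rw [one_pow, one_mul]
      exact sub_nonneg.2 (hgood t ht).1.le)
    (by simp [show N x = 1 from hxS, show N y = 1 from hyS]) (by simp [fderiv_tangentVec]) hs
  simpa using key
end

/-! ### The contractions -/

/-- The linear map that sends `x` to `y` and `tangentVec N x` to `c • tangentVec N y`, for unit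
vectors `x` and `y`. -/
noncomputable def frameMap (N : Seminorm ℝ Plane) (c : ℝ) (x y : Plane) : Plane →ₗ[ℝ] Plane where
  toFun w := fderiv ℝ N x w • y + (c * wedge x w) • tangentVec N y
  map_add' u w := by
    simp only [wedge, map_add, PiLp.add_apply]
    module
  map_smul' a w := by
    simp only [wedge, map_smul, PiLp.smul_apply, smul_eq_mul, RingHom.id_apply]
    module

theorem frameMap_apply (N : Seminorm ℝ Plane) (c : ℝ) (x y w : Plane) :
    frameMap N c x y w = fderiv ℝ N x w • y + (c * wedge x w) • tangentVec N y := rfl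

theorem opNorm_le {N : Seminorm ℝ Plane} {T : Plane →ₗ[ℝ] Plane} {C : ℝ}
    (h : ∀ w, N w ≤ 1 → N (T w) ≤ C) : opNorm N T ≤ C := by
  refine csSup_le ⟨_, 0, by simp, rfl⟩ ?_
  rintro _ ⟨w, hw, rfl⟩
  exact h w hw

section

variable {N : Seminorm ℝ Plane} {z : Plane}

theorem IsC2Norm.frameMap_self (hC2 : IsC2Norm N) {x : Plane} (hx : x ∈ unitSphere N) (c : ℝ)
    (y : Plane) : frameMap N c x y x = y := by
  rw [frameMap_apply, hC2.fderiv_self (ne_zero_of_mem_unitSphere hx), show N x = 1 from hx]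
  simp [wedge, mul_comm]

theorem IsC2Norm.frameMap_diag (hC2 : IsC2Norm N) (hz : z ∈ unitSphere N) (c : ℝ) (w : Plane) :
    frameMap N c z z w = c • w + (1 - c) • fderiv ℝ N z w • z := by
  conv_rhs => rw [hC2.decomp hz w]
  simp only [frameMap_apply, map_add, map_smul, fderiv_tangentVec,
    hC2.fderiv_self (ne_zero_of_mem_unitSphere hz), show N z = 1 from hz, smul_eq_mul]
  module

theorem IsC2Norm.frameMap_injective (hC2 : IsC2Norm N) {x y : Plane} (hx : x ∈ unitSphere N)
    (hy : y ∈ unitSphere N) {c : ℝ} (hc : c ≠ 0) : Function.Injective (frameMap N c x y) := by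
  refine (injective_iff_map_eq_zero _).2 fun w hw => ?_
  have h1 : fderiv ℝ N x w = 0 := by
    have := congrArg (fderiv ℝ N y) hw
    simpa [frameMap_apply, fderiv_tangentVec, hC2.fderiv_self (ne_zero_of_mem_unitSphere hy),
      show N y = 1 from hy] using this
  have h2 : wedge x w = 0 := by
    rw [frameMap_apply, h1] at hw
    simpa [hc, hC2.tangentVec_ne_zero hy] using hw
  rw [hC2.decomp hx w, h1, h2]
  simp

theorem continuous_wedge : Continuous fun p : Plane × Plane => wedge p.1 p.2 := by
  unfold wedge
  fun_prop

theorem IsC2Norm.continuousAt_frameMap (hC2 : IsC2Norm N) (hz : z ≠ 0) (c : ℝ) (w : Plane) :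
    ContinuousAt (fun p : (Plane × Plane) × Plane => frameMap N c p.1.1 p.1.2 p.2)
      ((z, z), w) := by
  have h1 : ContinuousAt (fun p : (Plane × Plane) × Plane => tangentVec N p.1.2) ((z, z), w) :=
    ContinuousAt.comp (f := fun p : (Plane × Plane) × Plane => p.1.2) (x := ((z, z), w))
      (hC2.continuousAt_tangentVec hz) (by fun_prop)
  have h2 : ContinuousAt (fun p : (Plane × Plane) × Plane => fderiv ℝ N p.1.1) ((z, z), w) :=
    ContinuousAt.comp (f := fun p : (Plane × Plane) × Plane => p.1.1) (x := ((z, z), w))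
      (hC2.continuousAt_fderiv hz) (by fun_prop)
  have h3 : Continuous (fun p : (Plane × Plane) × Plane => wedge p.1.1 p.2) :=
    continuous_wedge.comp (by fun_prop : Continuous fun p : (Plane × Plane) × Plane => (p.1.1, p.2))
  have h4 := h2.clm_apply (continuous_snd.continuousAt (x := ((z, z), w)))
  simp only [frameMap_apply]
  exact (h4.smul (by fun_prop)).add ((continuousAt_const.mul h3.continuousAt).smul h1)

/-- For fixed `c < 1` and unit vectors `x`, `y` close to `z`, the map `frameMap N c x y` does not
increase the norm of vectors near a given `w ≠ 0`. If `w` is not a multiple of `z` the inequality is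
strict at `x = y = z`; otherwise it is the comparison along tangent lines. -/
theorem IsC2Norm.eventually_frameMap_le (hC2 : IsC2Norm N) (hN : IsNormOnPlane N)
    (hz : z ∈ unitSphere N)
    (hpos : 0 < fderiv ℝ (fderiv ℝ N) z (tangentVec N z) (tangentVec N z))
    {c : ℝ} (hc0 : 0 ≤ c) (hc1 : c < 1) {w : Plane} (hw : w ≠ 0) :
    ∀ᶠ p : (Plane × Plane) × Plane in 𝓝 ((z, z), w),
      p.1.1 ∈ unitSphere N → p.1.2 ∈ unitSphere N →
        N (frameMap N c p.1.1 p.1.2 p.2) ≤ N p.2 := by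
  have hz0 := ne_zero_of_mem_unitSphere hz
  have hNc := continuous_seminorm_plane N
  by_cases hzw : wedge z w = 0
  · have hf : fderiv ℝ N z w ≠ 0 := by
      intro h
      refine hw ?_
      rw [hC2.decomp hz w, h, hzw]
      simp
    have h1 : ContinuousAt (fun p : (Plane × Plane) × Plane => fderiv ℝ N p.1.1) ((z, z), w) :=
      ContinuousAt.comp (f := fun p : (Plane × Plane) × Plane => p.1.1) (x := ((z, z), w))
        (hC2.continuousAt_fderiv hz0) (by fun_prop)
    have h2 : ContinuousAt (fun p : (Plane × Plane) × Plane => fderiv ℝ N p.1.1 p.2) ((z, z), w) :=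
      h1.clm_apply continuousAt_snd
    have h3 : Continuous (fun p : (Plane × Plane) × Plane => wedge p.1.1 p.2) :=
      continuous_wedge.comp
        (by fun_prop : Continuous fun p : (Plane × Plane) × Plane => (p.1.1, p.2))
    -- `s` is the slope of `p.2` in the frame at `p.1.1`; it tends to zero.
    have h4 : Tendsto (fun p : (Plane × Plane) × Plane =>
        (p.1.1, p.1.2, wedge p.1.1 p.2 / fderiv ℝ N p.1.1 p.2)) (𝓝 ((z, z), w))
        (𝓝 (z, z, 0)) := by
      have h5 : ContinuousAt (fun p : (Plane × Plane) × Plane =>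
          (p.1.1, p.1.2, wedge p.1.1 p.2 / fderiv ℝ N p.1.1 p.2)) ((z, z), w) :=
        ContinuousAt.prodMk (by fun_prop)
          (ContinuousAt.prodMk (by fun_prop) (h3.continuousAt.div h2 hf))
      simpa [ContinuousAt, hzw] using h5
    filter_upwards [h4.eventually (hC2.eventually_tangent_line_le hz hpos hc0 hc1),
      h2.eventually_ne hf] with ⟨⟨x, y⟩, u⟩ hle ha hx hy
    have hle := hle hx hy
    simp only at hle ha ⊢
    set a := fderiv ℝ N x u with hadef
    have e1 : frameMap N c x y u = a • (y + (c * (wedge x u / a)) • tangentVec N y) := by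
      rw [frameMap_apply, ← hadef, smul_add, smul_smul]
      congr 2
      field_simp
    have e2 : u = a • (x + (wedge x u / a) • tangentVec N x) := by
      conv_lhs => rw [hC2.decomp hx u, ← hadef]
      rw [smul_add, smul_smul]
      congr 2
      field_simp
    rw [e1]
    conv_rhs => rw [e2]
    rw [map_smul_eq_mul, map_smul_eq_mul]
    exact mul_le_mul_of_nonneg_left hle (norm_nonneg _)
  · have hlt : N (frameMap N c z z w) < N w := by
      rw [hC2.frameMap_diag hz]
      calc N (c • w + (1 - c) • fderiv ℝ N z w • z)
          ≤ N (c • w) + N ((1 - c) • fderiv ℝ N z w • z) := map_add_le_add N _ _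
        _ = c * N w + (1 - c) * |fderiv ℝ N z w| := by
            rw [map_smul_eq_mul, map_smul_eq_mul, map_smul_eq_mul, Real.norm_of_nonneg hc0,
              Real.norm_of_nonneg (by linarith), show N z = 1 from hz, mul_one, Real.norm_eq_abs]
        _ < N w := by nlinarith [hC2.abs_fderiv_lt hN hz hpos hzw]
    have h1 : ContinuousAt (fun p : (Plane × Plane) × Plane => N (frameMap N c p.1.1 p.1.2 p.2))
        ((z, z), w) := ContinuousAt.comp hNc.continuousAt (hC2.continuousAt_frameMap hz0 c w)
    have h2 : ContinuousAt (fun p : (Plane × Plane) × Plane => N p.2) ((z, z), w) :=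
      (hNc.comp continuous_snd).continuousAt
    filter_upwards [h1.eventually_lt h2 hlt] with p hp _ _ using hp.le

/-- Unit vectors near a given unit vector `z` are related by contractions close to the identity. The
contraction is `frameMap N c x y`, where `c < 1` depends on `ε` only. -/
theorem IsC2Norm.eventually_exists_contraction (hC2 : IsC2Norm N) (hN : IsNormOnPlane N)
    (hz : z ∈ unitSphere N)
    (hpos : 0 < fderiv ℝ (fderiv ℝ N) z (tangentVec N z) (tangentVec N z))
    {ε : ℝ} (hε : 0 < ε) :
    ∀ᶠ p : Plane × Plane in 𝓝 (z, z), p.1 ∈ unitSphere N → p.2 ∈ unitSphere N →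
      ∃ T : Plane ≃ₗ[ℝ] Plane,
        opNorm N (T : Plane →ₗ[ℝ] Plane) ≤ 1 ∧ T p.1 = p.2 ∧
        opNorm N ((T : Plane →ₗ[ℝ] Plane) - LinearMap.id) < ε := by
  have hz0 := ne_zero_of_mem_unitSphere hz
  have hNc := continuous_seminorm_plane N
  -- At `x = y = z` the map is within `2 (1 - c)` of the identity.
  obtain ⟨c, hc0, hc1, hcε⟩ : ∃ c : ℝ, 0 < c ∧ c < 1 ∧ 2 * (1 - c) < ε / 2 := by
    refine ⟨max (1 / 2) (1 - ε / 8), by positivity, max_lt (by norm_num) (by linarith), ?_⟩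
    have := le_max_right (1 / 2) (1 - ε / 8)
    linarith
  have hcontr : ∀ᶠ p : Plane × Plane in 𝓝 (z, z), ∀ w ∈ unitSphere N,
      p.1 ∈ unitSphere N → p.2 ∈ unitSphere N → N (frameMap N c p.1 p.2 w) ≤ N w :=
    (isCompact_unitSphere hN).eventually_forall_of_forall_eventually fun w hw =>
      hC2.eventually_frameMap_le hN hz hpos hc0.le hc1 (ne_zero_of_mem_unitSphere hw)
  have hnear : ∀ᶠ p : Plane × Plane in 𝓝 (z, z), ∀ w ∈ {w : Plane | N w ≤ 1},
      N (frameMap N c p.1 p.2 w - w) < ε / 2 := by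
    refine (isCompact_unitBall hN).eventually_forall_of_forall_eventually fun w hw => ?_
    have hw : N w ≤ 1 := hw
    have h1 : ContinuousAt
        (fun p : (Plane × Plane) × Plane => N (frameMap N c p.1.1 p.1.2 p.2 - p.2)) ((z, z), w) :=
      ContinuousAt.comp hNc.continuousAt
        ((hC2.continuousAt_frameMap hz0 c w).sub continuousAt_snd)
    refine h1.eventually_lt_const ?_
    have e : frameMap N c z z w - w = (1 - c) • (fderiv ℝ N z w • z - w) := by
      rw [hC2.frameMap_diag hz]
      module
    have h2 : N (fderiv ℝ N z w • z - w) ≤ 2 := by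
      have h3 := map_sub_le_add N (fderiv ℝ N z w • z) w
      rw [map_smul_eq_mul, show N z = 1 from hz, mul_one, Real.norm_eq_abs] at h3
      linarith [hC2.abs_fderiv_le hz0 w]
    simp only
    rw [e, map_smul_eq_mul, Real.norm_of_nonneg (by linarith)]
    nlinarith
  filter_upwards [hcontr, hnear] with ⟨x, y⟩ h1 h2 hx hy
  have hle : ∀ w, N (frameMap N c x y w) ≤ N w := by
    intro w
    rcases eq_or_ne w 0 with rfl | hw
    · simp
    · have hp := hN.pos hw
      have := h1 ((N w)⁻¹ • w) (by
        show N _ = 1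
        rw [map_smul_eq_mul, Real.norm_of_nonneg (inv_nonneg.2 hp.le), inv_mul_cancel₀ hp.ne'])
        hx hy
      rw [map_smul, map_smul_eq_mul, map_smul_eq_mul] at this
      exact le_of_mul_le_mul_left this (norm_pos_iff.2 (inv_ne_zero hp.ne'))
  refine ⟨LinearEquiv.ofInjectiveEndo _ (hC2.frameMap_injective hx hy hc0.ne'), ?_, ?_, ?_⟩
  · exact opNorm_le fun w hw => (hle w).trans hw
  · exact hC2.frameMap_self hx c y
  · refine lt_of_le_of_lt (opNorm_le (C := ε / 2) fun w hw => ?_) (half_lt_self hε)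
    exact (h2 w hw).le
end

theorem theorem4p2 (N : Seminorm ℝ Plane) (hN : IsNormOnPlane N) (hC2 : IsC2Norm N)
    (hcurv : ∀ x ∈ unitSphere N, ∃ κ : ℝ, 0 < κ ∧ HasCurvatureAt (unitSphere N) x κ) :
    IsUMST N := by
  intro ε hε
  have hNc := continuous_seminorm_plane N
  set G : Set (Plane × Plane) := {p | p.1 ∈ unitSphere N → p.2 ∈ unitSphere N →
      ∃ T : Plane ≃ₗ[ℝ] Plane,
        opNorm N (T : Plane →ₗ[ℝ] Plane) ≤ 1 ∧ T p.1 = p.2 ∧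
        opNorm N ((T : Plane →ₗ[ℝ] Plane) - LinearMap.id) < ε} with hG
  have hdiag : ∀ z ∈ unitSphere N, (z, z) ∈ interior G := by
    intro z hz
    obtain ⟨κ, hκ, hcz⟩ := hcurv z hz
    exact mem_interior_iff_mem_nhds.2 (hC2.eventually_exists_contraction hN hz
      (hC2.fderiv_fderiv_tangentVec_pos hz hκ hcz) hε)
  -- `N (x - y)` is positive, hence bounded below, on the compact set of pairs outside `interior G`.
  have hcpt : IsCompact ((unitSphere N ×ˢ unitSphere N) \ interior G) :=
    ((isCompact_unitSphere hN).prod (isCompact_unitSphere hN)).diff isOpen_interior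
  have hcont : Continuous fun p : Plane × Plane => N (p.1 - p.2) :=
    hNc.comp (continuous_fst.sub continuous_snd)
  obtain ⟨δ, hδ, hmin⟩ := hcpt.exists_forall_le' (a := 0) hcont.continuousOn (by
    rintro ⟨x, y⟩ ⟨⟨hx, hy⟩, hxy⟩
    refine hN.pos (sub_ne_zero.2 fun h => hxy ?_)
    have h : x = y := h
    exact h ▸ hdiag x hx)
  refine ⟨δ, hδ, fun x hx y hy hxy => ?_⟩
  by_contra hT
  have hnot : (x, y) ∉ interior G := fun h => hT (interior_subset h hx hy)
  exact absurd (hmin (x, y) ⟨⟨hx, hy⟩, hnot⟩) (not_le.2 hxy)
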